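/- All graphs are finite, simple and undirected. A $k$-tree is a graph obtained from the complete graph $K_k$ by repeatedly choosing a clique on $k$ vertices and joining all of its vertices to a new vertex; a graph has treewidth at most $k$ if it is a subgraph of a $k$-tree. For a set $S$ of vertices, $G[S]$ is the induced subgraph with vertex set $S$. Theorem 2. Let $G$ be a graph with $n$ vertices and $m$ edges. (1) There is a set $S$ of vertices such that $G[S]$ has treewidth at most $2$ and $|S|\ge n-\frac m5$. (2) Such a set is found by the following procedure. Start with $S=\emptyset$ and with the current graph equal to $G$. As long as the current graph has an edge, perform the first applicable step: (a) if some vertex has degree at least $5$, delete such a vertex; (b) if some vertex $v$ has degree one or two, contract an edge $vw$ at $v$ (the merged vertex is called $w$), remove the resulting self-loops and parallel edges, and add $v$ to $S$; (c) if some vertex has degree three, delete a vertex of the largest degree among the vertices that are adjacent to a vertex of degree three; (d) otherwise, delete a vertex of maximum degree. When no edges are left, add all remaining vertices to $S$. The procedure can always be carried out to the end, and, however the choices in it are made, the returned set $S$ satisfies: $G[S]$ has treewidth at most $2$ and $|S|\ge n-\frac m5$. (3) The bound is tight for arbitrarily large graphs: if $G$ is the disjoint union of $t\ge 0$ copies of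 $K_5$, then every vertex set $S$ for which $G[S]$ has treewidth at most $2$ satisfies $|S|\le n-\frac m5$. -/

import Mathlib

namespace InducedSubgraph

/-- The graph obtained from `T` by adding one new vertex `none`, joined to the vertices in `Q`. -/
def attachVertex {V : Type} (T : SimpleGraph V) (Q : Finset V) : SimpleGraph (Option V) :=
  SimpleGraph.fromRel fun x y =>
    (∃ a b, x = some a ∧ y = some b ∧ T.Adj a b) ∨ (x = none ∧ ∃ q ∈ Q, y = some q)

/-- `k`-trees (up to isomorphism): the graphs built from the complete graph on `k` vertices by
repeatedly picking a clique on `k` vertices and joining all of it to a new vertex. -/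
inductive IsKTree (k : ℕ) : {V : Type} → SimpleGraph V → Prop
  | complete : IsKTree k (⊤ : SimpleGraph (Fin k))
  | attach {V : Type} {T : SimpleGraph V} {Q : Finset V} :
      IsKTree k T → T.IsNClique k Q → IsKTree k (attachVertex T Q)

/-- `G` has treewidth at most `k`: it is a partial `k`-tree, that is, it is isomorphic to a
(not necessarily induced, not necessarily spanning) subgraph of a `k`-tree. -/
def TreewidthAtMost {V : Type*} (G : SimpleGraph V) (k : ℕ) : Prop :=
  ∃ (U : Type) (T : SimpleGraph U), IsKTree k T ∧ G.IsContained T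

/-- The degree of a vertex, as the cardinality of its neighbourhood. -/
noncomputable def deg {V : Type*} (H : SimpleGraph V) (v : V) : ℕ :=
  (H.neighborSet v).ncard

/-- Contraction of the edge `vw`, the merged vertex being called `w`, followed by the removal of
self-loops and parallel edges. The vertex `v` is left behind without edges. -/
def contractInto {V : Type*} (H : SimpleGraph V) (v w : V) : SimpleGraph V :=
  SimpleGraph.fromRel fun x y => x ≠ v ∧ y ≠ v ∧ (H.Adj x y ∨ (x = w ∧ H.Adj v y))

/-- `Run H W S`: the nondeterministic reduction procedure, started on the graph with edges `H` and
with set `W` of remaining vertices, can return the vertex set `S`.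
Vertices outside `W` have already been contracted away or deleted. -/
inductive Run {V : Type*} [DecidableEq V] : SimpleGraph V → Finset V → Finset V → Prop
  /-- No edges are left: keep the remaining isolated vertices. -/
  | finish {H : SimpleGraph V} {W : Finset V} : H = ⊥ → Run H W W
  /-- While there are vertices of degree at least `5`, delete one of them. -/
  | deleteHigh {H : SimpleGraph V} {W S : Finset V} (v : V) :
      5 ≤ deg H v →
      Run (H.deleteIncidenceSet v) (W.erase v) S → Run H W S
  /-- Otherwise, if there is a vertex `v` of degree one or two, contract an edge at it and
  keep `v`. -/
  | contract {H : SimpleGraph V} {W S : Finset V} (v w : V) :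
      (∀ x, deg H x ≤ 4) →
      (deg H v = 1 ∨ deg H v = 2) → H.Adj v w →
      Run (contractInto H v w) (W.erase v) S → Run H W (insert v S)
  /-- Otherwise, if there is a vertex of degree three, delete a vertex of the largest degree among
  those adjacent to a vertex of degree three. -/
  | deleteNearThree {H : SimpleGraph V} {W S : Finset V} (u v : V) :
      (∀ x, deg H x ≤ 4) → (∀ x, deg H x ≠ 1 ∧ deg H x ≠ 2) →
      deg H u = 3 → H.Adj u v →
      (∀ x y, deg H x = 3 → H.Adj x y → deg H y ≤ deg H v) →
      Run (H.deleteIncidenceSet v) (W.erase v) S → Run H W S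
  /-- Otherwise, if there are edges, delete a vertex of maximum degree. -/
  | deleteMax {H : SimpleGraph V} {W S : Finset V} (v : V) :
      (∀ x, deg H x ≤ 4) → (∀ x, deg H x ≠ 1 ∧ deg H x ≠ 2 ∧ deg H x ≠ 3) →
      H ≠ ⊥ → (∀ x, deg H x ≤ deg H v) →
      Run (H.deleteIncidenceSet v) (W.erase v) S → Run H W S

/-- The disjoint union of `t` copies of the complete graph on five vertices. -/
def copiesOfK5 (t : ℕ) : SimpleGraph (Fin t × Fin 5) :=
  SimpleGraph.fromRel fun x y => x.1 = y.1

end InducedSubgraph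

/-! At most m/5 vertices are deleted, and the contracted vertices can be put back without exceeding
treewidth 2.

Deleting a vertex of degree d lowers the degree sum 2m by 2d, so it suffices that each deletion pays
10. Degree at least 5 pays this at once; degrees 4 and 3 pay only 8 and 6. The rest comes from
`potential`, the degree sum minus a `bonus` for each component. The bonus is a minimum of three
terms: the degree sum, which gives isolated vertices nothing; the sum of 4 - deg, which gives
4-regular components nothing; and a term that caps the bonus at 2 when all degrees exceed 2, as they
do in every component with edges once no contraction applies. While all degrees are at most 4,
contractions do not raise the potential (`potential_contractInto_le`), and each deletion lowers it
by at least 10 (`potential_deleteMax`, `potential_deleteNearThree_of_four`,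
`potential_deleteNearThree_of_three`), because the neighbours of the deleted vertex create new
bonus.

For the treewidth, the run is undone from its end: contraction makes the at most two neighbours of
the contracted vertex adjacent, so it can be attached to a 2-tree (`Run.treewidthAtMost_two`). For
tightness, 2-trees contain no K₄ (`IsKTree.cliqueFree`), so at most 3 = 5 - 10/5 vertices survive in
each K₅. -/

namespace InducedSubgraph

/-! ### Degrees under deletion and contraction. -/

section Degrees

variable {V : Type*}

theorem deg_eq_degree [Fintype V] (H : SimpleGraph V) [DecidableRel H.Adj] (v : V) :
    deg H v = H.degree v := by
  rw [deg, Set.ncard_eq_toFinset_card', ← SimpleGraph.card_neighborFinset_eq_degree]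
  rfl

theorem sum_deg [Fintype V] (H : SimpleGraph V) : ∑ v, deg H v = 2 * H.edgeSet.ncard := by
  classical
  simp only [deg_eq_degree]
  rw [SimpleGraph.sum_degrees_eq_twice_card_edges, Set.ncard_eq_toFinset_card']
  rfl

theorem deg_pos_of_adj [Fintype V] {H : SimpleGraph V} {v w : V} (h : H.Adj v w) : 0 < deg H v :=
  (Set.ncard_pos (Set.toFinite _)).2 ⟨w, h⟩

theorem exists_adj_of_deg_pos [Fintype V] {H : SimpleGraph V} {v : V} (h : 0 < deg H v) :
    ∃ w, H.Adj v w :=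
  (Set.ncard_pos (Set.toFinite _)).1 h

theorem deg_congr {H H' : SimpleGraph V} {x : V} (h : ∀ y, H.Adj x y ↔ H'.Adj x y) :
    deg H x = deg H' x := by
  unfold deg
  congr 1
  ext y
  exact h y

theorem deg_bot (x : V) : deg (⊥ : SimpleGraph V) x = 0 := by
  simp [deg, SimpleGraph.neighborSet]

theorem exists_deg_pos [Fintype V] {H : SimpleGraph V} (h : H ≠ ⊥) : ∃ v, 0 < deg H v := by
  obtain ⟨v, w, hvw⟩ := SimpleGraph.ne_bot_iff_exists_adj.1 h
  exact ⟨v, deg_pos_of_adj hvw⟩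

theorem deg_deleteIncidenceSet_self [Fintype V] (H : SimpleGraph V) (v : V) :
    deg (H.deleteIncidenceSet v) v = 0 := by
  rw [deg, Set.ncard_eq_zero (Set.toFinite _)]
  ext y
  simp [SimpleGraph.deleteIncidenceSet_adj]

theorem deg_deleteIncidenceSet_of_adj [Fintype V] {H : SimpleGraph V} {v x : V}
    (h : H.Adj v x) : deg (H.deleteIncidenceSet v) x + 1 = deg H x := by
  have : (H.deleteIncidenceSet v).neighborSet x = H.neighborSet x \ {v} := by
    ext y
    simp only [SimpleGraph.mem_neighborSet, SimpleGraph.deleteIncidenceSet_adj, Set.mem_sdiff,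
      Set.mem_singleton_iff]
    have := h.ne'
    tauto
  rw [deg, deg, this]
  exact Set.ncard_sdiff_singleton_add_one h.symm (Set.toFinite _)

theorem deg_deleteIncidenceSet_of_not_adj {H : SimpleGraph V} {v x : V}
    (h : ¬ H.Adj v x) (hx : x ≠ v) : deg (H.deleteIncidenceSet v) x = deg H x := by
  refine deg_congr fun y => ?_
  rw [SimpleGraph.deleteIncidenceSet_adj]
  refine ⟨fun k => k.1, fun k => ⟨k, hx, ?_⟩⟩
  rintro rfl
  exact h k.symm

theorem deg_deleteIncidenceSet_le [Fintype V] (H : SimpleGraph V) (v x : V) :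
    deg (H.deleteIncidenceSet v) x ≤ deg H x :=
  Set.ncard_le_ncard (fun _ hy => ((H.deleteIncidenceSet_adj).1 hy).1) (Set.toFinite _)

theorem sum_deg_deleteIncidenceSet [Fintype V] (H : SimpleGraph V) (v : V) :
    ∑ x, deg (H.deleteIncidenceSet v) x + 2 * deg H v = ∑ x, deg H x := by
  classical
  have key : ∀ x, deg H x = deg (H.deleteIncidenceSet v) x + (if H.Adj v x then 1 else 0)
      + (if x = v then deg H v else 0) := by
    intro x
    by_cases hx : x = v
    · subst hx
      simp [deg_deleteIncidenceSet_self]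
    · by_cases hv : H.Adj v x
      · simp [hx, hv, deg_deleteIncidenceSet_of_adj hv]
      · simp [hx, hv, deg_deleteIncidenceSet_of_not_adj hv hx]
  have hcard : ∑ x, (if H.Adj v x then 1 else 0) = deg H v := by
    rw [deg_eq_degree, ← SimpleGraph.card_neighborFinset_eq_degree,
      SimpleGraph.neighborFinset_eq_filter, Finset.card_filter]
  rw [Finset.sum_congr rfl fun x _ => key x, Finset.sum_add_distrib, Finset.sum_add_distrib, hcard]
  simp
  ring

theorem contractInto_adj {H : SimpleGraph V} {v w x y : V} :
    (contractInto H v w).Adj x y ↔ x ≠ y ∧ x ≠ v ∧ y ≠ v ∧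
      (H.Adj x y ∨ (x = w ∧ H.Adj v y) ∨ (y = w ∧ H.Adj v x)) := by
  simp only [contractInto, SimpleGraph.fromRel_adj, H.adj_comm y x]
  tauto

theorem deg_contractInto_self [Fintype V] (H : SimpleGraph V) (v w : V) :
    deg (contractInto H v w) v = 0 := by
  rw [deg, Set.ncard_eq_zero (Set.toFinite _)]
  ext y
  simp [contractInto_adj]

theorem deg_contractInto_target [Fintype V] {H : SimpleGraph V} {v w : V} (h : H.Adj v w) :
    deg (contractInto H v w) w + 2 ≤ deg H w + deg H v := by
  have hsub : (contractInto H v w).neighborSet w ⊆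
      (H.neighborSet w \ {v}) ∪ (H.neighborSet v \ {w}) := by
    intro y hy
    obtain ⟨h1, h2, h3, h4⟩ := contractInto_adj.1 hy
    rcases h4 with h4 | ⟨-, h4⟩ | ⟨rfl, h4⟩
    · exact Or.inl ⟨h4, h3⟩
    · exact Or.inr ⟨h4, h1.symm⟩
    · exact absurd rfl h1
  have h1 := Set.ncard_le_ncard hsub (Set.toFinite _)
  have h2 := Set.ncard_union_le (H.neighborSet w \ {v}) (H.neighborSet v \ {w})
  have h3 := Set.ncard_sdiff_singleton_add_one (show v ∈ H.neighborSet w from h.symm)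
    (Set.toFinite _)
  have h4 := Set.ncard_sdiff_singleton_add_one (show w ∈ H.neighborSet v from h) (Set.toFinite _)
  unfold deg
  omega

theorem deg_contractInto_of_ne [Fintype V] {H : SimpleGraph V} {v w x : V} (hxw : x ≠ w) :
    deg (contractInto H v w) x ≤ deg H x := by
  by_cases hvx : H.Adj v x
  · have hsub : (contractInto H v w).neighborSet x ⊆ insert w (H.neighborSet x \ {v}) := by
      intro y hy
      obtain ⟨h1, h2, h3, h4⟩ := contractInto_adj.1 hy
      rcases h4 with h4 | ⟨h4, -⟩ | ⟨rfl, h4⟩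
      · exact Or.inr ⟨h4, h3⟩
      · exact absurd h4 hxw
      · exact Or.inl rfl
    have h1 := Set.ncard_le_ncard hsub (Set.toFinite _)
    have h2 := Set.ncard_insert_le w (H.neighborSet x \ {v})
    have h3 := Set.ncard_sdiff_singleton_add_one (show v ∈ H.neighborSet x from hvx.symm)
      (Set.toFinite _)
    unfold deg
    omega
  · refine Set.ncard_le_ncard (fun y hy => ?_) (Set.toFinite _)
    obtain ⟨h1, h2, h3, h4⟩ := contractInto_adj.1 hy
    tauto

theorem deg_contractInto_le [Fintype V] {H : SimpleGraph V} {v w : V}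
    (hv : deg H v = 1 ∨ deg H v = 2)
    (h : H.Adj v w) (x : V) : deg (contractInto H v w) x ≤ deg H x := by
  by_cases hxv : x = v
  · subst hxv
    simp [deg_contractInto_self]
  · by_cases hxw : x = w
    · subst hxw
      have := deg_contractInto_target h
      omega
    · exact deg_contractInto_of_ne hxw

end Degrees

/-! ### Components, their bonus, and the change of the potential in each step. -/

section Potential

variable {V : Type*}

open Classical in
/-- The vertex set of the connected component of `x`. -/
noncomputable def comp [Fintype V] (H : SimpleGraph V) (x : V) : Finset V :=
  Finset.univ.filter fun y => H.Reachable x y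

theorem mem_comp [Fintype V] {H : SimpleGraph V} {x y : V} : y ∈ comp H x ↔ H.Reachable x y := by
  simp [comp]

theorem self_mem_comp [Fintype V] (H : SimpleGraph V) (x : V) : x ∈ comp H x := mem_comp.2 .rfl

theorem comp_eq_of_mem [Fintype V] {H : SimpleGraph V} {x y : V} (h : y ∈ comp H x) :
    comp H y = comp H x := by
  ext z
  rw [mem_comp] at *
  rw [mem_comp]
  exact ⟨fun k => h.trans k, fun k => h.symm.trans k⟩

theorem mem_comp_of_adj [Fintype V] {H : SimpleGraph V} {x y z : V} (h : y ∈ comp H x)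
    (hyz : H.Adj y z) :
    z ∈ comp H x :=
  mem_comp.2 ((mem_comp.1 h).trans hyz.reachable)

theorem comp_subset_comp [Fintype V] {H H' : SimpleGraph V} (hle : H' ≤ H) {v x : V}
    (h : x ∈ comp H v) :
    comp H' x ⊆ comp H v := fun _ hy =>
  mem_comp.2 ((mem_comp.1 h).trans ((mem_comp.1 hy).mono hle))

/-- Induction along edges inside a component. -/
theorem comp_induction [Fintype V] {H : SimpleGraph V} {v : V} {P : V → Prop} (hv : P v)
    (step : ∀ x y, x ∈ comp H v → P x → H.Adj x y → P y) : ∀ x ∈ comp H v, P x := by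
  intro x hx
  have hx' := (SimpleGraph.reachable_iff_reflTransGen v x).1 (mem_comp.1 hx)
  clear hx
  induction hx' with
  | refl => exact hv
  | tail h hadj ih =>
    exact step _ _ (mem_comp.2 ((SimpleGraph.reachable_iff_reflTransGen _ _).2 h)) ih hadj

theorem deg_pos_of_mem_comp [Fintype V] {H : SimpleGraph V} {v x : V} (hv : 0 < deg H v)
    (hx : x ∈ comp H v) : 0 < deg H x :=
  comp_induction (P := fun x => 0 < deg H x) hv (fun _ _ _ _ h => deg_pos_of_adj h.symm) x hx

/-- Handshake lemma for the graph that keeps only the edges inside the component. -/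
theorem even_sum_deg_comp [Fintype V] (H : SimpleGraph V) (x : V) :
    Even (∑ y ∈ comp H x, deg H y) := by
  classical
  let K : SimpleGraph V :=
    { Adj := fun a b => H.Adj a b ∧ a ∈ comp H x
      symm := ⟨fun a b h => ⟨h.1.symm, mem_comp_of_adj h.2 h.1⟩⟩
      loopless := ⟨fun a h => h.1.ne rfl⟩ }
  have h1 : ∑ y ∈ comp H x, deg H y = ∑ y, deg K y := by
    rw [← Finset.sum_subset (Finset.subset_univ (comp H x))]
    · exact Finset.sum_congr rfl fun y hy => deg_congr fun z => ⟨fun h => ⟨h, hy⟩, fun h => h.1⟩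
    · intro y _ hy
      rw [deg, Set.ncard_eq_zero (Set.toFinite _)]
      ext z
      exact ⟨fun h => hy h.2, fun h => h.elim⟩
  rw [h1, sum_deg]
  exact even_two_mul _

open Classical in
/-- The vertex sets of the connected components. -/
noncomputable def comps [Fintype V] (H : SimpleGraph V) : Finset (Finset V) :=
  Finset.univ.image (comp H)

theorem comp_mem_comps [Fintype V] (H : SimpleGraph V) (x : V) : comp H x ∈ comps H := by
  simp [comps]

open Classical in
/-- The saving guaranteed by the component `A`, counted in half-edges. -/
noncomputable def bonus (H : SimpleGraph V) (A : Finset V) : ℤ :=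
  min (∑ x ∈ A, (deg H x : ℤ))
    (min (∑ x ∈ A, (4 - deg H x : ℤ)) (2 + 2 * ((A.filter fun x => deg H x ≤ 2).card : ℤ)))

/-- The total saving of all components. -/
noncomputable def totalBonus [Fintype V] (H : SimpleGraph V) : ℤ := ∑ A ∈ comps H, bonus H A

theorem bonus_nonneg {H : SimpleGraph V} (h4 : ∀ x, deg H x ≤ 4) (A : Finset V) :
    0 ≤ bonus H A := by
  refine le_min (by positivity) (le_min (Finset.sum_nonneg fun x _ => ?_) (by positivity))
  have := h4 x
  omega

theorem totalBonus_nonneg [Fintype V] {H : SimpleGraph V} (h4 : ∀ x, deg H x ≤ 4) :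
    0 ≤ totalBonus H :=
  Finset.sum_nonneg fun A _ => bonus_nonneg h4 A

theorem totalBonus_bot [Fintype V] : totalBonus (⊥ : SimpleGraph V) = 0 := by
  refine le_antisymm (Finset.sum_nonpos fun A _ => (min_le_left _ _).trans ?_)
    (totalBonus_nonneg fun x => by simp [deg_bot])
  simp [deg_bot]

theorem bonus_congr {H H' : SimpleGraph V} {A : Finset V} (h : ∀ x ∈ A, deg H x = deg H' x) :
    bonus H A = bonus H' A := by
  unfold bonus
  have h1 : ∑ x ∈ A, (deg H x : ℤ) = ∑ x ∈ A, (deg H' x : ℤ) :=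
    Finset.sum_congr rfl fun x hx => by rw [h x hx]
  have h2 : ∑ x ∈ A, (4 - deg H x : ℤ) = ∑ x ∈ A, (4 - deg H' x : ℤ) :=
    Finset.sum_congr rfl fun x hx => by rw [h x hx]
  rw [h1, h2, Finset.filter_congr fun x hx => by rw [h x hx]]

/-- If `H` and `H'` differ only inside the component of `v` in `H`, the total bonus changes by
what happens inside this component. -/
theorem totalBonus_transfer [Fintype V] {H H' : SimpleGraph V} {v : V} (h4 : ∀ x, deg H' x ≤ 4)
    (hadj : ∀ x, x ∉ comp H v → ∀ y, H.Adj x y ↔ H'.Adj x y)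
    {T : Finset (Finset V)} (hT : ∀ A ∈ T, A ∈ comps H' ∧ A ⊆ comp H v) :
    totalBonus H + ∑ A ∈ T, bonus H' A ≤ totalBonus H' + bonus H (comp H v) := by
  classical
  have hout : ∀ A ∈ (comps H).erase (comp H v), ∀ x ∈ A, x ∉ comp H v := by
    intro A hA x hx hxv
    obtain ⟨hne, hA⟩ := Finset.mem_erase.1 hA
    obtain ⟨z, -, rfl⟩ := Finset.mem_image.1 hA
    exact hne ((comp_eq_of_mem hx).symm.trans (comp_eq_of_mem hxv))
  have hsub : (comps H).erase (comp H v) ⊆ comps H' := by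
    intro A hA
    have hA' := hout A hA
    obtain ⟨z, -, rfl⟩ := Finset.mem_image.1 (Finset.mem_erase.1 hA).2
    have : comp H z = comp H' z := by
      ext y
      refine ⟨fun hy => ?_, fun hy => ?_⟩
      · exact comp_induction (P := fun y => y ∈ comp H' z) (self_mem_comp _ _)
          (fun a b ha ha' hab => mem_comp_of_adj ha' ((hadj a (hA' a ha) b).1 hab)) y hy
      · exact comp_induction (P := fun y => y ∈ comp H z) (self_mem_comp _ _)
          (fun a b _ ha' hab => mem_comp_of_adj ha' ((hadj a (hA' a ha') b).2 hab)) y hy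
    rw [this]
    exact comp_mem_comps _ _
  have hdisj : Disjoint ((comps H).erase (comp H v)) T := by
    rw [Finset.disjoint_left]
    intro A hA hAT
    obtain ⟨h1, h2⟩ := hT A hAT
    obtain ⟨z, -, rfl⟩ := Finset.mem_image.1 h1
    exact hout _ hA z (self_mem_comp _ _) (h2 (self_mem_comp _ _))
  have h1 : ∑ A ∈ (comps H).erase (comp H v), bonus H A
      = ∑ A ∈ (comps H).erase (comp H v), bonus H' A :=
    Finset.sum_congr rfl fun A hA => bonus_congr fun x hx => deg_congr (hadj x (hout A hA x hx))
  -- `H'` may have further components inside `comp H v`; they are dropped, which needs their bonus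
  -- to be nonnegative.
  have h2 : ∑ A ∈ (comps H).erase (comp H v) ∪ T, bonus H' A ≤ totalBonus H' :=
    Finset.sum_le_sum_of_subset_of_nonneg
      (Finset.union_subset hsub fun A hA => (hT A hA).1) fun A _ _ => bonus_nonneg h4 A
  rw [Finset.sum_union hdisj, ← h1] at h2
  have h3 := Finset.add_sum_erase (comps H) (bonus H) (comp_mem_comps H v)
  unfold totalBonus at *
  linarith

/-- The sum of 4 - deg over a component is even, so a single vertex of degree 3, which contributes
only 1, already forces it up to 2. -/
theorem two_le_bonus [Fintype V] {H : SimpleGraph V} (h4 : ∀ x, deg H x ≤ 4) {x : V}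
    (h2 : 2 ≤ deg H x)
    (h3 : deg H x ≤ 3) : 2 ≤ bonus H (comp H x) := by
  have hx := self_mem_comp H x
  have ha : (deg H x : ℤ) ≤ ∑ y ∈ comp H x, (deg H y : ℤ) :=
    Finset.single_le_sum (f := fun y => (deg H y : ℤ)) (fun _ _ => by positivity) hx
  have hb : (4 - deg H x : ℤ) ≤ ∑ y ∈ comp H x, (4 - deg H y : ℤ) :=
    Finset.single_le_sum (f := fun y => (4 - deg H y : ℤ))
      (fun y _ => by have := h4 y; omega) hx
  have hev : ∑ y ∈ comp H x, (4 - deg H y : ℤ)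
      = 4 * (comp H x).card - ((∑ y ∈ comp H x, deg H y : ℕ) : ℤ) := by
    rw [Finset.sum_sub_distrib]
    simp [mul_comm]
  obtain ⟨k, hk⟩ := even_sum_deg_comp H x
  refine le_min (by omega) (le_min ?_ (by positivity |> fun h => le_add_of_nonneg_right h))
  rw [hk] at hev
  push_cast at hev
  omega

/-- Lower bound for the bonus of `A` from the degree sums over a subset `R` and a set `Q` of
vertices of degree at most two. -/
theorem le_bonus_of_subset {H : SimpleGraph V} (h4 : ∀ x, deg H x ≤ 4) {A R : Finset V} {k : ℤ}
    (hR : R ⊆ A) (h1 : k ≤ ∑ x ∈ R, (deg H x : ℤ)) (h2 : k ≤ ∑ x ∈ R, (4 - deg H x : ℤ))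
    {Q : Finset V} (hQ : Q ⊆ A) (hQ2 : ∀ x ∈ Q, deg H x ≤ 2) (h3 : k ≤ 2 + 2 * (Q.card : ℤ)) :
    k ≤ bonus H A := by
  refine le_min (h1.trans ?_) (le_min (h2.trans ?_) (h3.trans ?_))
  · exact Finset.sum_le_sum_of_subset_of_nonneg hR fun _ _ _ => by positivity
  · exact Finset.sum_le_sum_of_subset_of_nonneg hR fun x _ _ => by have := h4 x; omega
  · have : Q.card ≤ (A.filter fun x => deg H x ≤ 2).card :=
      Finset.card_le_card fun x hx => Finset.mem_filter.2 ⟨hQ hx, hQ2 x hx⟩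
    omega

theorem bonus_le_two {H : SimpleGraph V} {A : Finset V} (h : ∀ x ∈ A, 2 < deg H x) :
    bonus H A ≤ 2 := by
  refine (min_le_right _ _).trans ((min_le_right _ _).trans ?_)
  rw [Finset.filter_false_of_mem fun x hx => not_le.2 (h x hx)]
  simp

/-- The potential that pays for the deletions. -/
noncomputable def potential [Fintype V] (H : SimpleGraph V) : ℤ :=
  (∑ x, (deg H x : ℤ)) - totalBonus H

/-- The component of `v` loses `v` and otherwise stays connected. Its degree sum drops by some d ≥
2: `v` accounts for `deg H v`, and `w` for at least `2 - deg H v`. The three terms of the bonus drop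
by d, 4 - d and at most 2, none of which exceeds d. -/
theorem potential_contractInto_le [Fintype V] [DecidableEq V] {H : SimpleGraph V} {v w : V}
    (h4 : ∀ x, deg H x ≤ 4)
    (hv : deg H v = 1 ∨ deg H v = 2) (h : H.Adj v w) :
    potential (contractInto H v w) ≤ potential H := by
  classical
  set H' := contractInto H v w with hH'
  have hle : ∀ x, deg H' x ≤ deg H x := deg_contractInto_le hv h
  have hself : deg H' v = 0 := deg_contractInto_self H v w
  have htgt : deg H' w + 2 ≤ deg H w + deg H v := deg_contractInto_target h
  have hvC : v ∈ comp H v := self_mem_comp H v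
  have hwC : w ∈ comp H v := mem_comp_of_adj hvC h
  have hwC' : w ∈ (comp H v).erase v := Finset.mem_erase.2 ⟨h.ne', hwC⟩
  have hcomp : comp H' w = (comp H v).erase v := by
    refine Finset.Subset.antisymm (fun y hy => ?_) fun y hy => ?_
    · refine comp_induction (P := fun y => y ∈ (comp H v).erase v) hwC' ?_ y hy
      intro a b _ ha hab
      obtain ⟨h1, h2, h3, h5⟩ := contractInto_adj.1 hab
      refine Finset.mem_erase.2 ⟨h3, ?_⟩
      rcases h5 with h5 | ⟨-, h5⟩ | ⟨rfl, -⟩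
      · exact mem_comp_of_adj (Finset.mem_of_mem_erase ha) h5
      · exact mem_comp_of_adj hvC h5
      · exact hwC
    · obtain ⟨hyv, hy⟩ := Finset.mem_erase.1 hy
      refine comp_induction (P := fun y => y ≠ v → y ∈ comp H' w) (fun k => absurd rfl k)
        ?_ y hy hyv
      intro a b ha ih hab hb
      by_cases hav : a = v
      · subst hav
        by_cases hbw : b = w
        · subst hbw
          exact self_mem_comp _ _
        · exact mem_comp_of_adj (self_mem_comp H' w)
            (contractInto_adj.2 ⟨Ne.symm hbw, h.ne', hb, Or.inr (Or.inl ⟨rfl, hab⟩)⟩)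
      · exact mem_comp_of_adj (ih hav) (contractInto_adj.2 ⟨hab.ne, hav, hb, Or.inl hab⟩)
  have htrans := totalBonus_transfer (H := H) (H' := H') (v := v)
    (fun x => (hle x).trans (h4 x)) (T := {comp H' w}) ?_ ?_
  · rw [Finset.sum_singleton, hcomp] at htrans
    set R := ((comp H v).erase v).erase w with hR
    have split : ∀ f : V → ℤ, ∑ x ∈ comp H v, f x = f v + (f w + ∑ x ∈ R, f x) := by
      intro f
      rw [Finset.add_sum_erase _ f hwC', Finset.add_sum_erase _ f hvC]
    have split' : ∀ f : V → ℤ, ∑ x ∈ (comp H v).erase v, f x = f w + ∑ x ∈ R, f x := by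
      intro f
      rw [Finset.add_sum_erase _ f hwC']
    have hRle : ∑ x ∈ R, (deg H' x : ℤ) ≤ ∑ x ∈ R, (deg H x : ℤ) :=
      Finset.sum_le_sum fun x _ => by exact_mod_cast hle x
    have htot : ∑ x ∈ comp H v, ((deg H x : ℤ) - deg H' x) ≤ ∑ x, ((deg H x : ℤ) - deg H' x) :=
      Finset.sum_le_sum_of_subset_of_nonneg (Finset.subset_univ _)
        fun x _ _ => by have := hle x; omega
    rw [split, Finset.sum_sub_distrib, Finset.sum_sub_distrib] at htot
    have hcard : ((comp H v).filter fun x => deg H x ≤ 2).card ≤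
        (((comp H v).erase v).filter fun x => deg H' x ≤ 2).card + 1 := by
      have : ((comp H v).filter fun x => deg H x ≤ 2) ⊆
          insert v (((comp H v).erase v).filter fun x => deg H' x ≤ 2) := by
        intro x hx
        obtain ⟨hx1, hx2⟩ := Finset.mem_filter.1 hx
        by_cases hxv : x = v
        · simp [hxv]
        · simp [hxv, hx1, (hle x).trans hx2]
      exact (Finset.card_le_card this).trans (Finset.card_insert_le _ _)
    have hb : bonus H (comp H v) ≤ bonus H' ((comp H v).erase v)
        + ((∑ x, (deg H x : ℤ)) - ∑ x, (deg H' x : ℤ)) := by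
      have e : ∀ (K : SimpleGraph V) (A : Finset V), bonus K A =
          min (∑ x ∈ A, (deg K x : ℤ)) (min (∑ x ∈ A, (4 - deg K x : ℤ))
            (2 + 2 * ((A.filter fun x => deg K x ≤ 2).card : ℤ))) := by
        intro K A
        unfold bonus
        congr!
      rw [e, e, split, split, split', split']
      simp only [Finset.sum_sub_distrib]
      omega
    unfold potential
    linarith
  · intro x hx y
    rw [hH', contractInto_adj]
    constructor
    · intro hxy
      refine ⟨hxy.ne, ?_, ?_, Or.inl hxy⟩
      · rintro rfl
        exact hx hvC
      · rintro rfl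
        exact hx (mem_comp_of_adj hvC hxy.symm)
    · rintro ⟨-, -, -, k | ⟨rfl, -⟩ | ⟨-, k⟩⟩
      · exact k
      · exact absurd hwC hx
      · exact absurd (mem_comp_of_adj hvC k) hx
  · intro A hA
    rw [Finset.mem_singleton.1 hA]
    exact ⟨comp_mem_comps _ _, hcomp ▸ Finset.erase_subset _ _⟩

/-- The effect of a vertex deletion on the potential, in terms of some of the components that it
creates. -/
theorem potential_deleteIncidenceSet_le [Fintype V] [DecidableEq V] {H : SimpleGraph V} {v : V}
    (h4 : ∀ x, deg H x ≤ 4) {X : Finset V} (hX : ∀ x ∈ X, H.Adj v x) :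
    potential (H.deleteIncidenceSet v)
        + ∑ A ∈ X.image (comp (H.deleteIncidenceSet v)), bonus (H.deleteIncidenceSet v) A
        + 2 * deg H v
      ≤ potential H + bonus H (comp H v) := by
  have hvC := self_mem_comp H v
  have htrans := totalBonus_transfer (H := H) (H' := H.deleteIncidenceSet v) (v := v)
    (fun x => (deg_deleteIncidenceSet_le H v x).trans (h4 x))
    (T := X.image (comp (H.deleteIncidenceSet v))) ?_ ?_
  · have hsum := sum_deg_deleteIncidenceSet H v
    zify at hsum
    unfold potential
    linarith
  · intro x hx y
    rw [SimpleGraph.deleteIncidenceSet_adj]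
    refine ⟨fun hxy => ⟨hxy, ?_, ?_⟩, fun k => k.1⟩
    · rintro rfl
      exact hx hvC
    · rintro rfl
      exact hx (mem_comp_of_adj hvC hxy.symm)
  · intro A hA
    obtain ⟨x, hx, rfl⟩ := Finset.mem_image.1 hA
    exact ⟨comp_mem_comps _ _, comp_subset_comp (H.deleteIncidenceSet_le v)
      (mem_comp_of_adj hvC (hX x hx))⟩

/-- The component of `v` is 4-regular and has no bonus. Deletion lowers the degree sum by 8 and
leaves a neighbour of degree 3, whose component earns the missing 2. -/
theorem potential_deleteMax [Fintype V] {H : SimpleGraph V} {v : V}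
    (h4 : ∀ x, deg H x ≤ 4) (h123 : ∀ x, deg H x ≠ 1 ∧ deg H x ≠ 2 ∧ deg H x ≠ 3)
    (hv : 0 < deg H v) : potential (H.deleteIncidenceSet v) + 10 ≤ potential H := by
  classical
  have hfour : ∀ x ∈ comp H v, deg H x = 4 := fun x hx => by
    have := deg_pos_of_mem_comp hv hx
    have := h4 x
    have := h123 x
    omega
  have hvv := hfour v (self_mem_comp H v)
  obtain ⟨u, hu⟩ := exists_adj_of_deg_pos hv
  have h1 := potential_deleteIncidenceSet_le h4 (X := {u}) (by simpa using hu)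
  have hb : bonus H (comp H v) ≤ 0 := by
    refine (min_le_right _ _).trans ((min_le_left _ _).trans (Finset.sum_nonpos fun x hx => ?_))
    rw [hfour x hx]
    norm_num
  have hu4 := hfour u (mem_comp_of_adj (self_mem_comp H v) hu)
  have hu3 := deg_deleteIncidenceSet_of_adj hu
  have hb' := two_le_bonus (fun x => (deg_deleteIncidenceSet_le H v x).trans (h4 x))
    (x := u) (by omega) (by omega)
  simp only [Finset.image_singleton, Finset.sum_singleton, hvv] at h1
  push_cast at h1
  linarith

/-- The degree sum drops by 8 and a bonus of at most 2 is lost, so the neighbours of `v` must earn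
4. -/
theorem potential_deleteNearThree_of_four [Fintype V] {H : SimpleGraph V} {u v : V}
    (h4 : ∀ x, deg H x ≤ 4) (h12 : ∀ x, deg H x ≠ 1 ∧ deg H x ≠ 2)
    (hu : deg H u = 3) (huv : H.Adj u v) (hv : deg H v = 4) :
    potential (H.deleteIncidenceSet v) + 10 ≤ potential H := by
  classical
  set H' := H.deleteIncidenceSet v with hH'
  have h4' : ∀ x, deg H' x ≤ 4 := fun x => (deg_deleteIncidenceSet_le H v x).trans (h4 x)
  have hthree : ∀ x ∈ comp H v, 2 < deg H x := fun x hx => by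
    have := deg_pos_of_mem_comp (by omega) hx
    have := h12 x
    omega
  have hb := bonus_le_two hthree
  have hnb : ∀ x, H.Adj v x → 2 ≤ deg H' x ∧ deg H' x ≤ 3 := fun x hx => by
    have h1 : deg H' x + 1 = deg H x := deg_deleteIncidenceSet_of_adj hx
    have h2 := hthree x (mem_comp_of_adj (self_mem_comp H v) hx)
    have h3 := h4 x
    omega
  have hu' : deg H' u = 2 := by
    have : deg H' u + 1 = deg H u := deg_deleteIncidenceSet_of_adj huv.symm
    omega
  suffices h : ∃ X : Finset V, (∀ x ∈ X, H.Adj v x) ∧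
      4 ≤ ∑ A ∈ X.image (comp H'), bonus H' A by
    obtain ⟨X, hX, hXb⟩ := h
    have h1 := potential_deleteIncidenceSet_le h4 hX
    rw [hv] at h1
    push_cast at h1
    linarith
  -- In a common component, `u` of degree 2 and two more neighbours of degree 2 or 3 bring every
  -- term of the bonus to 4. Otherwise two components earn 2 each.
  by_cases hall : ∀ x, H.Adj v x → x ∈ comp H' u
  · refine ⟨{u}, by simpa using huv.symm, ?_⟩
    rw [Finset.image_singleton, Finset.sum_singleton]
    have hcard : 2 < (H.neighborSet v).ncard := by
      change 2 < deg H v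
      omega
    obtain ⟨a, b, c, ha, hbn, hc, hab, hac, hbc⟩ := Set.two_lt_ncard_iff (Set.toFinite _) |>.1 hcard
    obtain ⟨p, q, hp, hq, hpu, hqu, hpq⟩ :
        ∃ p q, H.Adj v p ∧ H.Adj v q ∧ u ≠ p ∧ u ≠ q ∧ p ≠ q := by
      by_cases hua : u = a
      · subst hua
        exact ⟨b, c, hbn, hc, hab, hac, hbc⟩
      · by_cases hub : u = b
        · subst hub
          exact ⟨a, c, ha, hc, hua, hbc, hac⟩
        · exact ⟨a, b, ha, hbn, hua, hub, hab⟩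
    have hp' := hnb p hp
    have hq' := hnb q hq
    refine le_bonus_of_subset h4' (R := {u, p, q}) (Q := {u}) ?_ ?_ ?_ ?_ ?_ ?_
    · intro x hx
      simp only [Finset.mem_insert, Finset.mem_singleton] at hx
      rcases hx with rfl | rfl | rfl
      exacts [self_mem_comp _ _, hall _ hp, hall _ hq]
    · rw [Finset.sum_insert (by simp [hpu, hqu]), Finset.sum_pair hpq]
      omega
    · rw [Finset.sum_insert (by simp [hpu, hqu]), Finset.sum_pair hpq]
      omega
    · simpa using self_mem_comp H' u
    · simp [hu']
    · simp
  · push Not at hall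
    obtain ⟨x, hx, hxu⟩ := hall
    refine ⟨{u, x}, by simpa using ⟨huv.symm, hx⟩, ?_⟩
    have hne : comp H' u ≠ comp H' x := fun h => hxu (h ▸ self_mem_comp H' x)
    rw [Finset.image_insert, Finset.image_singleton, Finset.sum_pair hne]
    have h1 := two_le_bonus h4' (hnb u huv.symm).1 (hnb u huv.symm).2
    have h2 := two_le_bonus h4' (hnb x hx).1 (hnb x hx).2
    linarith

/-- Maximality of `v` spreads along edges, so its component is cubic. The degree sum drops by 6 and
a bonus of at most 2 is lost, so the neighbours of `v` must earn 6. -/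
theorem potential_deleteNearThree_of_three [Fintype V] {H : SimpleGraph V} {v : V}
    (h4 : ∀ x, deg H x ≤ 4) (h12 : ∀ x, deg H x ≠ 1 ∧ deg H x ≠ 2)
    (hv : deg H v = 3) (hmax : ∀ x y, deg H x = 3 → H.Adj x y → deg H y ≤ deg H v) :
    potential (H.deleteIncidenceSet v) + 10 ≤ potential H := by
  classical
  set H' := H.deleteIncidenceSet v with hH'
  have h4' : ∀ x, deg H' x ≤ 4 := fun x => (deg_deleteIncidenceSet_le H v x).trans (h4 x)
  have hthree : ∀ x ∈ comp H v, deg H x = 3 := by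
    refine comp_induction hv fun x y _ hx hxy => ?_
    have h1 := hmax x y hx hxy
    have h2 := deg_pos_of_adj hxy.symm
    have h3 := h12 y
    omega
  have hb : bonus H (comp H v) ≤ 2 := bonus_le_two fun x hx => by rw [hthree x hx]; norm_num
  have hmem : ∀ x, H.Adj v x → x ∈ comp H v := fun x hx => mem_comp_of_adj (self_mem_comp H v) hx
  have hnb : ∀ x, H.Adj v x → deg H' x = 2 := fun x hx => by
    have h1 : deg H' x + 1 = deg H x := deg_deleteIncidenceSet_of_adj hx
    have h2 := hthree x (hmem x hx)
    omega
  suffices h : ∃ X : Finset V, (∀ x ∈ X, H.Adj v x) ∧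
      6 ≤ ∑ A ∈ X.image (comp H'), bonus H' A by
    obtain ⟨X, hX, hXb⟩ := h
    have h1 := potential_deleteIncidenceSet_le h4 hX
    rw [hv] at h1
    push_cast at h1
    linarith
  obtain ⟨a, b, c, hab, hac, hbc, hN⟩ := Set.ncard_eq_three.1
      (show (H.neighborSet v).ncard = 3 from hv)
  have hadj : ∀ x, H.Adj v x ↔ x = a ∨ x = b ∨ x = c := fun x => by
    rw [← SimpleGraph.mem_neighborSet, hN]
    simp
  have ha := (hadj a).2 (by simp)
  -- In a common component, the three neighbours, now of degree 2, earn 6. Otherwise there are two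
  -- components, each earning 4: a neighbour of degree 2 together with its own two neighbours, of
  -- degree 1 to 3, suffices.
  by_cases hall : ∀ x, H.Adj v x → x ∈ comp H' a
  · refine ⟨{a}, by simpa using ha, ?_⟩
    rw [Finset.image_singleton, Finset.sum_singleton]
    have hsub : ({a, b, c} : Finset V) ⊆ comp H' a := fun x hx => by
      refine hall x ((hadj x).2 ?_)
      simpa using hx
    have h2 : ∀ x ∈ ({a, b, c} : Finset V), deg H' x = 2 := fun x hx =>
      hnb x ((hadj x).2 (by simpa using hx))
    have hc3 : ({a, b, c} : Finset V).card = 3 := Finset.card_eq_three.2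
        ⟨a, b, c, hab, hac, hbc, rfl⟩
    refine le_bonus_of_subset h4' hsub ?_ ?_ hsub (fun x hx => (h2 x hx).le) ?_
    · rw [Finset.sum_congr rfl fun x hx => by rw [h2 x hx], Finset.sum_const, hc3]
      norm_num
    · rw [Finset.sum_congr rfl fun x hx => by rw [h2 x hx], Finset.sum_const, hc3]
      norm_num
    · rw [hc3]
      norm_num
  · push Not at hall
    obtain ⟨x, hx, hxa⟩ := hall
    have hfour : ∀ y, H.Adj v y → 4 ≤ bonus H' (comp H' y) := by
      intro y hy
      obtain ⟨p, q, hpq, hN'⟩ := Set.ncard_eq_two.1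
          (show (H'.neighborSet y).ncard = 2 from hnb y hy)
      have hp : H'.Adj y p := by
        rw [← SimpleGraph.mem_neighborSet, hN']
        simp
      have hq : H'.Adj y q := by
        rw [← SimpleGraph.mem_neighborSet, hN']
        simp
      have hle3 : ∀ z, H'.Adj y z → deg H' z ≤ 3 := fun z hz =>
        (deg_deleteIncidenceSet_le H v z).trans
          (hthree z (mem_comp_of_adj (hmem y hy) (H.deleteIncidenceSet_le v hz))).le
      have hp1 := hle3 p hp
      have hq1 := hle3 q hq
      have hp2 := deg_pos_of_adj hp.symm
      have hq2 := deg_pos_of_adj hq.symm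
      have hy2 := hnb y hy
      have hns : y ∉ ({p, q} : Finset V) := by simp [hp.ne, hq.ne]
      refine le_bonus_of_subset h4' (R := {y, p, q}) (Q := {y}) ?_ ?_ ?_ ?_ ?_ ?_
      · intro z hz
        simp only [Finset.mem_insert, Finset.mem_singleton] at hz
        rcases hz with rfl | rfl | rfl
        exacts [self_mem_comp _ _, mem_comp_of_adj (self_mem_comp _ _) hp,
          mem_comp_of_adj (self_mem_comp _ _) hq]
      · rw [Finset.sum_insert hns, Finset.sum_pair hpq]
        omega
      · rw [Finset.sum_insert hns, Finset.sum_pair hpq]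
        omega
      · simpa using self_mem_comp H' y
      · simp [hy2]
      · simp
    refine ⟨{a, x}, by simpa using ⟨ha, hx⟩, ?_⟩
    have hne : comp H' a ≠ comp H' x := fun h => hxa (h ▸ self_mem_comp H' x)
    rw [Finset.image_insert, Finset.image_singleton, Finset.sum_pair hne]
    have h1 := hfour a ha
    have h2 := hfour x hx
    linarith

end Potential

/-! ### Number of deletions, and existence of a run. -/

section Procedure

variable {V : Type*} [DecidableEq V]

/-- Invariant of the procedure: vertices that are no longer present carry no edges. -/
theorem deleteIncidenceSet_support {H : SimpleGraph V} {W : Finset V}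
    (h : ∀ x y, H.Adj x y → x ∈ W) (v : V) :
    ∀ x y, (H.deleteIncidenceSet v).Adj x y → x ∈ W.erase v := fun x y hxy => by
  obtain ⟨h1, h2, -⟩ := (H.deleteIncidenceSet_adj).1 hxy
  exact Finset.mem_erase.2 ⟨h2, h x y h1⟩

theorem contractInto_support {H : SimpleGraph V} {W : Finset V}
    (h : ∀ x y, H.Adj x y → x ∈ W) {v w : V} (hvw : H.Adj v w) :
    ∀ x y, (contractInto H v w).Adj x y → x ∈ W.erase v := fun x y hxy => by
  obtain ⟨-, h2, -, h3 | ⟨rfl, -⟩ | ⟨-, h3⟩⟩ := contractInto_adj.1 hxy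
  · exact Finset.mem_erase.2 ⟨h2, h x y h3⟩
  · exact Finset.mem_erase.2 ⟨h2, h x v hvw.symm⟩
  · exact Finset.mem_erase.2 ⟨h2, h x v h3.symm⟩

/-- Ensures that a deleted vertex never returns and that a contracted vertex is counted only once.
-/
theorem Run.subset [Fintype V] {H : SimpleGraph V} {W S : Finset V} (hrun : Run H W S)
    (hW : ∀ x y, H.Adj x y → x ∈ W) : S ⊆ W := by
  induction hrun with
  | finish _ => exact Finset.Subset.refl _
  | deleteHigh v _ _ ih =>
    exact (ih (deleteIncidenceSet_support hW v)).trans (Finset.erase_subset _ _)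
  | contract v w _ _ hvw _ ih =>
    exact Finset.insert_subset (hW v w hvw)
      ((ih (contractInto_support hW hvw)).trans (Finset.erase_subset _ _))
  | deleteNearThree u v _ _ _ _ _ _ ih =>
    exact (ih (deleteIncidenceSet_support hW v)).trans (Finset.erase_subset _ _)
  | deleteMax v _ _ _ _ _ ih =>
    exact (ih (deleteIncidenceSet_support hW v)).trans (Finset.erase_subset _ _)

theorem card_le_card_erase_add_one (W : Finset V) (v : V) :
    (W.card : ℤ) ≤ (W.erase v).card + 1 := by
  have := Finset.pred_card_le_card_erase (s := W) (a := v)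
  omega

/-- The number of deleted vertices is bounded by the potential once the maximum degree is at most
four. -/
theorem Run.card_le_potential [Fintype V] {H : SimpleGraph V} {W S : Finset V} (hrun : Run H W S)
    (hW : ∀ x y, H.Adj x y → x ∈ W) (h4 : ∀ x, deg H x ≤ 4) :
    10 * ((W.card : ℤ) - S.card) ≤ potential H := by
  induction hrun with
  | finish h =>
    subst h
    simp [potential, totalBonus_bot, deg_bot]
  | deleteHigh v hv _ _ =>
    have := h4 v
    omega
  | @contract H W S v w _ hv hvw hr ih =>
    have h1 := ih (contractInto_support hW hvw)
      fun x => (deg_contractInto_le hv hvw x).trans (h4 x)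
    have h2 := potential_contractInto_le h4 hv hvw
    have h3 := card_le_card_erase_add_one W v
    have h5 : v ∉ S := fun h =>
      Finset.notMem_erase v W (hr.subset (contractInto_support hW hvw) h)
    rw [Finset.card_insert_of_notMem h5]
    push_cast
    linarith
  | @deleteNearThree H W S u v _ h12 hu huv hmax _ ih =>
    have h1 := ih (deleteIncidenceSet_support hW v)
      fun x => (deg_deleteIncidenceSet_le H v x).trans (h4 x)
    have h3 := card_le_card_erase_add_one W v
    have h2 : potential (H.deleteIncidenceSet v) + 10 ≤ potential H := by
      have hpos := deg_pos_of_adj huv.symm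
      have hv := h12 v
      have hv4 := h4 v
      obtain hv | hv : deg H v = 3 ∨ deg H v = 4 := by omega
      · exact potential_deleteNearThree_of_three h4 h12 hv hmax
      · exact potential_deleteNearThree_of_four h4 h12 hu huv hv
    linarith
  | @deleteMax H W S v _ h123 hne hmax _ ih =>
    have h1 := ih (deleteIncidenceSet_support hW v)
      fun x => (deg_deleteIncidenceSet_le H v x).trans (h4 x)
    have h3 := card_le_card_erase_add_one W v
    obtain ⟨x, hx⟩ := exists_deg_pos hne
    have h2 := potential_deleteMax h4 h123 (hx.trans_le (hmax x))
    linarith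

/-- Deletions at degree at least 5 are charged to the degree sum alone, since the bonus may be
negative there. From the first other step on, all degrees are at most 4 and the potential takes
over. -/
theorem Run.card_le_sum_deg [Fintype V] {H : SimpleGraph V} {W S : Finset V} (hrun : Run H W S)
    (hW : ∀ x y, H.Adj x y → x ∈ W) :
    10 * ((W.card : ℤ) - S.card) ≤ ∑ x, (deg H x : ℤ) := by
  have low : ∀ {H : SimpleGraph V} {W S : Finset V}, Run H W S →
      (∀ x y, H.Adj x y → x ∈ W) → (∀ x, deg H x ≤ 4) →
      10 * ((W.card : ℤ) - S.card) ≤ ∑ x, (deg H x : ℤ) := fun hrun hW h4 => by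
    have h1 := hrun.card_le_potential hW h4
    have h2 := totalBonus_nonneg h4
    unfold potential at h1
    linarith
  induction hrun with
  | finish h => simp only [sub_self, mul_zero]; positivity
  | @deleteHigh H W S v hv _ ih =>
    have h1 := ih (deleteIncidenceSet_support hW v)
    have h2 := sum_deg_deleteIncidenceSet H v
    have h3 := card_le_card_erase_add_one W v
    zify at h2 hv
    linarith
  | contract v w h4 hv hvw hr _ => exact low (.contract v w h4 hv hvw hr) hW h4
  | deleteNearThree u v h4 h12 hu huv hmax hr _ =>
    exact low (.deleteNearThree u v h4 h12 hu huv hmax hr) hW h4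
  | deleteMax v h4 h123 hne hmax hr _ => exact low (.deleteMax v h4 h123 hne hmax hr) hW h4

/-- Some step applies as long as there are edges, and each step strictly lowers the degree sum. -/
theorem exists_run [Fintype V] (H : SimpleGraph V) (W : Finset V) : ∃ S, Run H W S := by
  classical
  induction hn : ∑ x, deg H x using Nat.strong_induction_on generalizing H W with
  | _ n ih =>
    have del : ∀ v, 0 < deg H v → ∃ S, Run (H.deleteIncidenceSet v) (W.erase v) S := by
      intro v hv
      have := sum_deg_deleteIncidenceSet H v
      exact ih _ (by omega) _ _ rfl
    by_cases hbot : H = ⊥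
    · exact ⟨W, .finish hbot⟩
    by_cases h5 : ∃ v, 5 ≤ deg H v
    · obtain ⟨v, hv⟩ := h5
      obtain ⟨S, hS⟩ := del v (by omega)
      exact ⟨S, .deleteHigh v hv hS⟩
    have h4 : ∀ x, deg H x ≤ 4 := fun x => by
      by_contra hx
      exact h5 ⟨x, by omega⟩
    by_cases h12 : ∃ v, deg H v = 1 ∨ deg H v = 2
    · obtain ⟨v, hv⟩ := h12
      obtain ⟨w, hvw⟩ := exists_adj_of_deg_pos (show 0 < deg H v by omega)
      have hlt : ∑ x, deg (contractInto H v w) x < ∑ x, deg H x :=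
        Finset.sum_lt_sum (fun x _ => deg_contractInto_le hv hvw x)
          ⟨v, Finset.mem_univ _, by rw [deg_contractInto_self]; omega⟩
      obtain ⟨S, hS⟩ := ih _ (by omega) (contractInto H v w) (W.erase v) rfl
      exact ⟨insert v S, .contract v w h4 hv hvw hS⟩
    have h12' : ∀ x, deg H x ≠ 1 ∧ deg H x ≠ 2 := fun x =>
      ⟨fun h => h12 ⟨x, Or.inl h⟩, fun h => h12 ⟨x, Or.inr h⟩⟩
    by_cases h3 : ∃ u, deg H u = 3
    · obtain ⟨u, hu⟩ := h3
      obtain ⟨y, huy⟩ := exists_adj_of_deg_pos (show 0 < deg H u by omega)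
      obtain ⟨v, hv, hmax⟩ := Finset.exists_max_image
        (Finset.univ.filter fun y => ∃ x, deg H x = 3 ∧ H.Adj x y) (deg H)
        ⟨y, by simpa using ⟨u, hu, huy⟩⟩
      obtain ⟨-, x, hx, hxv⟩ := Finset.mem_filter.1 hv
      obtain ⟨S, hS⟩ := del v (deg_pos_of_adj hxv.symm)
      exact ⟨S, .deleteNearThree x v h4 h12' hx hxv
        (fun a b ha hab => hmax b (by simpa using ⟨a, ha, hab⟩)) hS⟩
    obtain ⟨x, hx⟩ := exists_deg_pos hbot
    obtain ⟨v, -, hmax⟩ := Finset.exists_max_image Finset.univ (deg H) ⟨x, Finset.mem_univ _⟩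
    obtain ⟨S, hS⟩ := del v (hx.trans_le (hmax x (Finset.mem_univ _)))
    exact ⟨S, .deleteMax v h4 (fun y => ⟨(h12' y).1, (h12' y).2, fun h => h3 ⟨y, h⟩⟩) hbot
      (fun y => hmax y (Finset.mem_univ _)) hS⟩

end Procedure

/-! ### Partial 2-trees and undoing the run. -/

section Treewidth

theorem attachVertex_some_some {U : Type} {T : SimpleGraph U} {Q : Finset U} {a b : U} :
    (attachVertex T Q).Adj (some a) (some b) ↔ T.Adj a b := by
  simp only [attachVertex, SimpleGraph.fromRel_adj]
  constructor
  · rintro ⟨-, (⟨x, y, hx, hy, h⟩ | ⟨h, -⟩) | (⟨x, y, hx, hy, h⟩ | ⟨h, -⟩)⟩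
    · cases hx; cases hy; exact h
    · cases h
    · cases hx; cases hy; exact h.symm
    · cases h
  · exact fun h => ⟨fun k => h.ne (Option.some.inj k), Or.inl (Or.inl ⟨a, b, rfl, rfl, h⟩)⟩

theorem attachVertex_none_some {U : Type} {T : SimpleGraph U} {Q : Finset U} {a : U} :
    (attachVertex T Q).Adj none (some a) ↔ a ∈ Q := by
  simp [attachVertex, SimpleGraph.fromRel_adj]

theorem IsKTree.exists_isNClique_mem {k : ℕ} (hk : 0 < k) {U : Type} {T : SimpleGraph U}
    (hT : IsKTree k T) (x : U) : ∃ Q : Finset U, T.IsNClique k Q ∧ x ∈ Q := by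
  classical
  induction hT with
  | complete =>
    refine ⟨Finset.univ, ⟨fun a _ b _ hab => hab, by simp⟩, Finset.mem_univ _⟩
  | @attach U T Q hT hQ ih =>
    cases x with
    | none =>
      obtain ⟨q, hq⟩ : Q.Nonempty := Finset.card_pos.1 (by rw [hQ.card_eq]; exact hk)
      -- `Q` with the new vertex has k + 1 vertices; one old vertex `q` is dropped to return to k.
      refine ⟨insert none ((Q.erase q).map Function.Embedding.some), ⟨?_, ?_⟩, by simp⟩
      · intro a ha b hb hab
        cases a <;> cases b
        · exact absurd rfl hab
        · exact attachVertex_none_some.2 (by simp at hb; exact hb.1)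
        · exact (attachVertex_none_some.2 (by simp at ha; exact ha.1)).symm
        · refine attachVertex_some_some.2 (hQ.isClique ?_ ?_ fun h => hab (by rw [h]))
          · simp at ha; exact ha.1
          · simp at hb; exact hb.1
      · rw [Finset.card_insert_of_notMem (by simp), Finset.card_map, Finset.card_erase_of_mem hq,
          hQ.card_eq]
        omega
    | some x =>
      obtain ⟨R, hR, hx⟩ := ih x
      refine ⟨R.map Function.Embedding.some, ⟨?_, by rw [Finset.card_map, hR.card_eq]⟩,
        by simpa using hx⟩
      intro a ha b hb hab
      simp only [Finset.coe_map, Set.mem_image, Finset.mem_coe] at ha hb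
      obtain ⟨a, ha, rfl⟩ := ha
      obtain ⟨b, hb, rfl⟩ := hb
      exact attachVertex_some_some.2 (hR.isClique ha hb fun h => hab (by rw [h]))

theorem IsKTree.nonempty {k : ℕ} (hk : 0 < k) {U : Type} {T : SimpleGraph U}
    (hT : IsKTree k T) : Nonempty U := by
  cases hT with
  | complete => exact ⟨⟨0, hk⟩⟩
  | attach _ _ => exact ⟨none⟩

/-- A clique through the newest vertex has all its other vertices among the k vertices of `Q`. -/
theorem IsKTree.cliqueFree {k : ℕ} {U : Type} {T : SimpleGraph U} (hT : IsKTree k T) :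
    T.CliqueFree (k + 2) := by
  classical
  induction hT with
  | complete =>
    intro s hs
    have := Finset.card_le_univ s
    rw [hs.card_eq, Fintype.card_fin] at this
    omega
  | @attach U T Q hT hQ ih =>
    intro s hs
    have hmem : ∀ a, a ∈ Finset.eraseNone s ↔ some a ∈ s := fun a => Finset.mem_eraseNone
    by_cases hn : none ∈ s
    · have hsub : Finset.eraseNone s ⊆ Q := fun a ha =>
        attachVertex_none_some.1 (hs.isClique hn ((hmem a).1 ha) (by simp))
      have h1 := Finset.card_le_card hsub
      have h2 : (Finset.eraseNone s).card + 1 = s.card := by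
        rw [← Finset.card_map Function.Embedding.some, Finset.map_some_eraseNone,
          Finset.card_erase_add_one hn]
      rw [hQ.card_eq] at h1
      have h3 := hs.card_eq
      omega
    · refine ih (Finset.eraseNone s) ⟨fun a ha b hb hab => ?_, ?_⟩
      · exact attachVertex_some_some.1
          (hs.isClique ((hmem a).1 ha) ((hmem b).1 hb) fun h => hab (Option.some.inj h))
      · rw [← Finset.card_map Function.Embedding.some, Finset.map_some_eraseNone,
          Finset.erase_eq_of_notMem hn, hs.card_eq]

variable {V : Type*}

/-- The embedding becomes a total function with arbitrary values outside `S`, so that `S` can grow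
without changing types. -/
theorem treewidthAtMost_induce_iff {k : ℕ} (hk : 0 < k) {H : SimpleGraph V} {S : Set V} :
    TreewidthAtMost (H.induce S) k ↔ ∃ (U : Type) (T : SimpleGraph U), IsKTree k T ∧
      ∃ f : V → U, Set.InjOn f S ∧ ∀ a ∈ S, ∀ b ∈ S, H.Adj a b → T.Adj (f a) (f b) := by
  classical
  constructor
  · rintro ⟨U, T, hT, ⟨f⟩⟩
    obtain ⟨u⟩ := hT.nonempty hk
    refine ⟨U, T, hT, fun a => if h : a ∈ S then f ⟨a, h⟩ else u, ?_, ?_⟩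
    · intro a ha b hb hab
      simp only [ha, hb, dif_pos] at hab
      exact congrArg Subtype.val (f.injective hab)
    · intro a ha b hb hab
      simp only [ha, hb, dif_pos]
      exact f.toHom.map_adj (v := ⟨a, ha⟩) (w := ⟨b, hb⟩) hab
  · rintro ⟨U, T, hT, f, hf, hadj⟩
    exact ⟨U, T, hT, ⟨⟨⟨fun a => f a, fun {a b} h => hadj a a.2 b b.2 h⟩,
      fun a b h => Subtype.ext (hf a.2 b.2 h)⟩⟩⟩

/-- Adding a vertex with at most two neighbours, which are adjacent if they are distinct, does not
make the treewidth exceed two. The old graph may have additional edges. -/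
theorem treewidthAtMost_two_insert [DecidableEq V] {H H' : SimpleGraph V} {S : Finset V} {v w x : V}
    (hS : TreewidthAtMost (H'.induce (S : Set V)) 2) (hv : v ∉ S)
    (hle : ∀ a ∈ S, ∀ b ∈ S, H.Adj a b → H'.Adj a b)
    (hN : ∀ a ∈ S, H.Adj v a → a = w ∨ a = x)
    (hwx : ∀ a ∈ S, ∀ b ∈ S, H.Adj v a → H.Adj v b → a ≠ b → H'.Adj a b) :
    TreewidthAtMost (H.induce ((insert v S : Finset V) : Set V)) 2 := by
  classical
  rw [treewidthAtMost_induce_iff two_pos] at hS ⊢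
  obtain ⟨U, T, hT, f, hf, hadj⟩ := hS
  obtain ⟨Q, hQ, hQN⟩ : ∃ Q : Finset U, T.IsNClique 2 Q ∧
      ∀ a ∈ S, H.Adj v a → f a ∈ Q := by
    by_cases h2 : ∃ a ∈ S, ∃ b ∈ S, H.Adj v a ∧ H.Adj v b ∧ a ≠ b
    · obtain ⟨a, ha, b, hb, hva, hvb, hab⟩ := h2
      have h := hadj a ha b hb (hwx a ha b hb hva hvb hab)
      refine ⟨{f a, f b}, ?_, ?_⟩
      · refine ⟨?_, Finset.card_pair h.ne⟩
        rw [Finset.coe_pair, SimpleGraph.isClique_pair]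
        exact fun _ => h
      · intro c hc hvc
        have h1 := hN a ha hva
        have h2 := hN b hb hvb
        have h3 := hN c hc hvc
        have : c = a ∨ c = b := by grind
        rcases this with rfl | rfl <;> simp
    -- With at most one neighbour in `S`, any 2-clique through its image serves; with none, `u` is
    -- arbitrary.
    · obtain ⟨u, hu⟩ : ∃ u : U, ∀ a ∈ S, H.Adj v a → f a = u := by
        by_cases h1 : ∃ a ∈ S, H.Adj v a
        · obtain ⟨a, ha, hva⟩ := h1
          refine ⟨f a, fun b hb hvb => ?_⟩
          by_contra hne
          exact h2 ⟨b, hb, a, ha, hvb, hva, fun h => hne (by rw [h])⟩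
        · obtain ⟨u⟩ := hT.nonempty two_pos
          exact ⟨u, fun a ha hva => absurd ⟨a, ha, hva⟩ h1⟩
      obtain ⟨Q, hQ, huQ⟩ := hT.exists_isNClique_mem two_pos u
      exact ⟨Q, hQ, fun a ha hva => by rw [hu a ha hva]; exact huQ⟩
  refine ⟨Option U, attachVertex T Q, hT.attach hQ, fun a => if a = v then none else some (f a),
    ?_, ?_⟩
  · intro a ha b hb hab
    simp only [Finset.coe_insert, Set.mem_insert_iff, Finset.mem_coe] at ha hb
    by_cases hav : a = v <;> by_cases hbv : b = v
    · rw [hav, hbv]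
    · simp [hav, hbv] at hab
    · simp [hav, hbv] at hab
    · simp only [hav, hbv, if_false, Option.some.injEq] at hab
      exact hf (ha.resolve_left hav) (hb.resolve_left hbv) hab
  · intro a ha b hb hab
    simp only [Finset.coe_insert, Set.mem_insert_iff, Finset.mem_coe] at ha hb
    by_cases hav : a = v <;> by_cases hbv : b = v
    · exact absurd (hav.trans hbv.symm) hab.ne
    · subst hav
      simp only [hbv, if_true, if_false]
      exact attachVertex_none_some.2 (hQN b (hb.resolve_left hbv) hab)
    · subst hbv
      simp only [hav, if_true, if_false]
      exact (attachVertex_none_some.2 (hQN a (ha.resolve_left hav) hab.symm)).symm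
    · simp only [hav, hbv, if_false]
      have ha' := ha.resolve_left hav
      have hb' := hb.resolve_left hbv
      exact attachVertex_some_some.2 (hadj a ha' b hb' (hle a ha' b hb' hab))

theorem treewidthAtMost_two_bot [DecidableEq V] (S : Finset V) :
    TreewidthAtMost ((⊥ : SimpleGraph V).induce (S : Set V)) 2 := by
  induction S using Finset.induction_on with
  | empty =>
    exact ⟨Fin 2, ⊤, .complete, ⟨⟨⟨fun a => absurd a.2 (by simp), fun {a} => absurd a.2 (by simp)⟩,
      fun a => absurd a.2 (by simp)⟩⟩⟩
  | insert v S hv ih =>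
    exact treewidthAtMost_two_insert (w := v) (x := v) ih hv (fun _ _ _ _ h => h)
      (fun _ _ h => absurd h (by simp)) (fun _ _ _ _ h => absurd h (by simp))

theorem TreewidthAtMost.of_adj {k : ℕ} (hk : 0 < k) {H H' : SimpleGraph V} {S : Set V}
    (h : TreewidthAtMost (H'.induce S) k) (hle : ∀ a ∈ S, ∀ b ∈ S, H.Adj a b → H'.Adj a b) :
    TreewidthAtMost (H.induce S) k := by
  rw [treewidthAtMost_induce_iff hk] at h ⊢
  obtain ⟨U, T, hT, f, hf, hadj⟩ := h
  exact ⟨U, T, hT, f, hf, fun a ha b hb hab => hadj a ha b hb (hle a ha b hb hab)⟩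

/-- A deletion does not affect the graph induced on `S`, since the deleted vertex is not in `S`. A
contraction joins `w` to the other neighbour of `v`, if there is one, so `v` can be attached to an
edge of the 2-tree. -/
theorem Run.treewidthAtMost_two [Fintype V] [DecidableEq V] {H : SimpleGraph V} {W S : Finset V}
    (hrun : Run H W S) (hW : ∀ x y, H.Adj x y → x ∈ W) :
    TreewidthAtMost (H.induce (S : Set V)) 2 := by
  have del : ∀ {H : SimpleGraph V} {W S : Finset V} {v : V}, (∀ x y, H.Adj x y → x ∈ W) →
      Run (H.deleteIncidenceSet v) (W.erase v) S →
      TreewidthAtMost ((H.deleteIncidenceSet v).induce (S : Set V)) 2 →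
      TreewidthAtMost (H.induce (S : Set V)) 2 := by
    intro H W S v hW hr h
    have hv : ∀ a ∈ S, a ≠ v := fun a ha =>
      Finset.ne_of_mem_erase (hr.subset (deleteIncidenceSet_support hW v) ha)
    exact h.of_adj two_pos fun a ha b hb hab =>
      (H.deleteIncidenceSet_adj).2 ⟨hab, hv a ha, hv b hb⟩
  induction hrun with
  | finish h =>
    subst h
    exact treewidthAtMost_two_bot _
  | deleteHigh v _ hr ih => exact del hW hr (ih (deleteIncidenceSet_support hW v))
  | deleteNearThree u v _ _ _ _ _ hr ih =>
    exact del hW hr (ih (deleteIncidenceSet_support hW v))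
  | deleteMax v _ _ _ _ hr ih => exact del hW hr (ih (deleteIncidenceSet_support hW v))
  | @contract H W S v w _ hv hvw hr ih =>
    have hne : ∀ a ∈ S, a ≠ v := fun a ha =>
      Finset.ne_of_mem_erase (hr.subset (contractInto_support hW hvw) ha)
    obtain ⟨x, hx⟩ : ∃ x, ∀ a, H.Adj v a → a = w ∨ a = x := by
      rcases hv with hv | hv
      · obtain ⟨y, hy⟩ := Set.ncard_eq_one.1 (show (H.neighborSet v).ncard = 1 from hv)
        refine ⟨y, fun a ha => Or.inr ?_⟩
        rw [← SimpleGraph.mem_neighborSet, hy] at ha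
        exact ha
      · obtain ⟨y, z, -, hyz⟩ := Set.ncard_eq_two.1 (show (H.neighborSet v).ncard = 2 from hv)
        have h : ∀ a, H.Adj v a ↔ a = y ∨ a = z := fun a => by
          rw [← SimpleGraph.mem_neighborSet, hyz]
          simp
        rcases (h w).1 hvw with rfl | rfl
        · exact ⟨z, fun a ha => (h a).1 ha⟩
        · exact ⟨y, fun a ha => ((h a).1 ha).symm⟩
    refine treewidthAtMost_two_insert (w := w) (x := x) (ih (contractInto_support hW hvw))
      (fun h => hne v h rfl) (fun a ha b hb hab => ?_) (fun a _ => hx a) ?_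
    · exact contractInto_adj.2 ⟨hab.ne, hne a ha, hne b hb, Or.inl hab⟩
    · intro a ha b hb hva hvb hab
      refine contractInto_adj.2 ⟨hab, hne a ha, hne b hb, Or.inr ?_⟩
      rcases hx a hva with rfl | rfl
      · exact Or.inl ⟨rfl, hvb⟩
      · rcases hx b hvb with rfl | rfl
        · exact Or.inr ⟨rfl, hva⟩
        · exact absurd rfl hab

end Treewidth

/-! ### Disjoint copies of K₅. -/

section Tightness

theorem copiesOfK5_adj {t : ℕ} {x y : Fin t × Fin 5} :
    (copiesOfK5 t).Adj x y ↔ x ≠ y ∧ x.1 = y.1 := by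
  simp only [copiesOfK5, SimpleGraph.fromRel_adj, eq_comm (a := y.1), or_self]

theorem deg_copiesOfK5_le {t : ℕ} (x : Fin t × Fin 5) : deg (copiesOfK5 t) x ≤ 4 := by
  have hsub : (copiesOfK5 t).neighborSet x ⊆
      (((Finset.univ.erase x.2).map ⟨Prod.mk x.1, Prod.mk_right_injective x.1⟩ :
        Finset (Fin t × Fin 5)) : Set (Fin t × Fin 5)) := by
    rintro ⟨i, j⟩ hy
    obtain ⟨h1, h2⟩ := copiesOfK5_adj.1 hy
    simp only [Finset.coe_map, Set.mem_image, Finset.mem_coe, Finset.mem_erase, Finset.mem_univ]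
    refine ⟨j, ⟨?_, trivial⟩, Prod.ext h2 rfl⟩
    rintro rfl
    exact h1 (Prod.ext h2 rfl)
  refine (Set.ncard_le_ncard hsub (Set.toFinite _)).trans ?_
  rw [Set.ncard_coe_finset, Finset.card_map, Finset.card_erase_of_mem (Finset.mem_univ _)]
  simp

/-- Only this direction is needed: fewer edges would make the bound n - m/5 larger. -/
theorem ncard_edgeSet_copiesOfK5_le (t : ℕ) : (copiesOfK5 t).edgeSet.ncard ≤ 10 * t := by
  have h1 := sum_deg (copiesOfK5 t)
  have h2 : ∑ x, deg (copiesOfK5 t) x ≤ ∑ _x : Fin t × Fin 5, 4 :=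
    Finset.sum_le_sum fun x _ => deg_copiesOfK5_le x
  simp at h2
  omega

/-- Four vertices of `S` in one copy would map to a 4-clique of a 2-tree. -/
theorem card_le_of_treewidthAtMost_two {t : ℕ} {S : Finset (Fin t × Fin 5)}
    (h : TreewidthAtMost ((copiesOfK5 t).induce (S : Set (Fin t × Fin 5))) 2) :
    S.card ≤ 3 * t := by
  classical
  obtain ⟨U, T, hT, f, hf, hadj⟩ := (treewidthAtMost_induce_iff two_pos).1 h
  have hfib : ∀ i : Fin t, (S.filter fun x => x.1 = i).card ≤ 3 := by
    intro i
    by_contra hlt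
    obtain ⟨R, hR, hRc⟩ := Finset.exists_subset_card_eq
        (show 4 ≤ (S.filter fun x => x.1 = i).card by omega)
    have hRS : ∀ x ∈ R, x ∈ S ∧ x.1 = i := fun x hx => Finset.mem_filter.1 (hR hx)
    refine hT.cliqueFree (R.image f) ⟨?_, ?_⟩
    · intro a ha b hb hab
      rw [Finset.mem_coe, Finset.mem_image] at ha hb
      obtain ⟨a, ha, rfl⟩ := ha
      obtain ⟨b, hb, rfl⟩ := hb
      exact hadj a (hRS a ha).1 b (hRS b hb).1 (copiesOfK5_adj.2
        ⟨fun k => hab (by rw [k]), (hRS a ha).2.trans (hRS b hb).2.symm⟩)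
    · rw [Finset.card_image_of_injOn fun a ha b hb => hf (hRS a ha).1 (hRS b hb).1, hRc]
  rw [Finset.card_eq_sum_card_fiberwise (f := Prod.fst) (t := Finset.univ) fun x _ => by simp]
  refine (Finset.sum_le_sum fun i _ => hfib i).trans ?_
  simp [mul_comm]

end Tightness

theorem Run.isLarge {V : Type*} [Fintype V] [DecidableEq V] {G : SimpleGraph V} {S : Finset V}
    (h : Run G Finset.univ S) :
    (Fintype.card V : ℝ) - (G.edgeSet.ncard : ℝ) / 5 ≤ (S.card : ℝ) := by
  have h1 := h.card_le_sum_deg fun _ _ _ => Finset.mem_univ _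
  have h2 := sum_deg G
  zify at h2
  rw [h2, Finset.card_univ] at h1
  have h3 : (10 : ℝ) * ((Fintype.card V : ℝ) - S.card) ≤ 2 * (G.edgeSet.ncard : ℝ) := by
    exact_mod_cast h1
  linarith

end InducedSubgraph

theorem theorem2 :
    (∀ (V : Type*) [Fintype V] (G : SimpleGraph V),
      ∃ S : Finset V, InducedSubgraph.TreewidthAtMost (G.induce (S : Set V)) 2 ∧
        (Fintype.card V : ℝ) - (G.edgeSet.ncard : ℝ) / 5 ≤ (S.card : ℝ)) ∧
    (∀ (V : Type*) [Fintype V] [DecidableEq V] (G : SimpleGraph V),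
      (∃ S : Finset V, InducedSubgraph.Run G Finset.univ S) ∧
      ∀ S : Finset V, InducedSubgraph.Run G Finset.univ S →
        InducedSubgraph.TreewidthAtMost (G.induce (S : Set V)) 2 ∧
        (Fintype.card V : ℝ) - (G.edgeSet.ncard : ℝ) / 5 ≤ (S.card : ℝ)) ∧
    (∀ (t : ℕ) (S : Finset (Fin t × Fin 5)),
      InducedSubgraph.TreewidthAtMost
        ((InducedSubgraph.copiesOfK5 t).induce (S : Set (Fin t × Fin 5))) 2 →
      (S.card : ℝ) ≤ (Fintype.card (Fin t × Fin 5) : ℝ)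
        - ((InducedSubgraph.copiesOfK5 t).edgeSet.ncard : ℝ) / 5) := by
  refine ⟨fun V _ G => ?_, fun V _ _ G => ⟨InducedSubgraph.exists_run G _, fun S h =>
    ⟨h.treewidthAtMost_two fun _ _ _ => Finset.mem_univ _, h.isLarge⟩⟩, fun t S h => ?_⟩
  · classical
    obtain ⟨S, hS⟩ := InducedSubgraph.exists_run G Finset.univ
    exact ⟨S, hS.treewidthAtMost_two fun _ _ _ => Finset.mem_univ _, hS.isLarge⟩
  · have h1 : (S.card : ℝ) ≤ 3 * t := by
      exact_mod_cast InducedSubgraph.card_le_of_treewidthAtMost_two h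
    have h2 : ((InducedSubgraph.copiesOfK5 t).edgeSet.ncard : ℝ) ≤ 10 * t := by
      exact_mod_cast InducedSubgraph.ncard_edgeSet_copiesOfK5_le t
    rw [Fintype.card_prod, Fintype.card_fin, Fintype.card_fin]
    push_cast
    linarith
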